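/- Let $\mathbb{T}$ be a finite limit theory with (small, finitely complete) syntactic category $\mathcal{C}$, and let $\mathbb{T}[\mathcal{S}]=\mathrm{Lex}[\mathcal{C},\mathbf{Set}]$ be its category of set-valued models, in which $c\in\mathcal{C}$ is identified with the corepresentable model $K_c=\mathcal{C}(c,-)$, so that an arrow $d\to c$ of $\mathcal{C}$ has a dual $K_c\to K_d$. Let $(\mathbb{T},\mathcal{V},J)$ be a geometry, i.e. - $\mathcal{V}$ is a saturated class: a class of maps between finitely presented objects of $\mathbb{T}[\mathcal{S}]$ that contains all isomorphisms between such objects, is closed under composition, under pushouts along maps between finitely presented objects and under finite colimits in the arrow category of $\mathbb{T}[\mathcal{S}]$, and is right-cancellative ($f\in\mathcal{V}$ and $gf\in\mathcal{V}$ imply $g\in\mathcal{V}$); - $J$ is a Grothendieck topology on $\mathcal{C}$ generated by families of arrows whose duals lie in $\mathcal{V}$. A model $A$ is *$J$-local* (equivalently, a model of the geometric extension $\mathbb{T}_J$ in $\mathbf{Set}$) if for the dual $(K\to K_i)_{i\in I}$ of any $J$-covering family, each map $K\to A$ factors through $K\to K_i$ for some $i\in I$. For a model $B$ let $\mathcal{V}_B$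 be the full subcategory of the coslice $B\downarrow\mathbb{T}[\mathcal{S}]$ on the maps $n:B\to D$ that are a pushout of some $K\to K'$ in $\mathcal{V}$ along some map $K\to B$. Let $J_B$ be the Grothendieck topology on $\mathcal{V}_B^{\mathrm{op}}$ generated by the duals of the families $(m_i:n\to n_i)_{i\in I}$ in $\mathcal{V}_B$, with $m_i:D\to D_i$ on codomains, for which there are a map $b:K\to D$ and the dual $(K\to K_i)_{i\in I}$ of a $J$-covering family such that each $m_i$ is the pushout of $K\to K_i$ along $b$. Put $\mathrm{Spec}(B)=\mathrm{Sh}(\mathcal{V}_B^{\mathrm{op}},J_B)$. **Proposition.** If $A$ is a $J$-local object of $\mathbb{T}[\mathcal{S}]$, then $\mathrm{Spec}(A)$ is a local topos: it is a Grothendieck topos, and the geometric morphism $\mathrm{Spec}(A)\to\mathbf{Set}$ is local, i.e. its inverse image functor is full and faithful and its direct image functor, the global section functor, has a further right adjoint. -/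

import Mathlib

open CategoryTheory CategoryTheory.Limits Opposite

universe u v w

namespace SpectralGeometry

section Toposes

/-- A Grothendieck topos: a category equivalent to the category of sheaves of (`u`-small) sets on
a `u`-small site. -/
def IsGrothendieckTopos (E : Type v) [Category.{w} E] : Prop :=
  ∃ (S : Type u) (_ : SmallCategory S) (J : GrothendieckTopology S),
    Nonempty (E ≌ Sheaf J (Type u))

/-- A geometric morphism `F ⟶ E`: an adjunction `f^* ⊣ f_*` whose left adjoint `f^* : E ⥤ F`
preserves finite limits. -/
structure GeometricMorphism (F : Type*) [Category F] (E : Type*) [Category E] where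
  /-- the inverse image functor `f^*` -/
  inverseImage : E ⥤ F
  /-- the direct image functor `f_*` -/
  directImage : F ⥤ E
  /-- the adjunction `f^* ⊣ f_*` -/
  adj : inverseImage ⊣ directImage
  /-- the inverse image functor preserves finite limits -/
  lex : PreservesFiniteLimits inverseImage

/-- A geometric morphism `f` is local if `f^*` is full and faithful and `f_*` has a further right
adjoint. -/
structure GeometricMorphism.IsLocal {F : Type*} [Category F] {E : Type*} [Category E]
    (f : GeometricMorphism F E) : Prop where
  full : f.inverseImage.Full
  faithful : f.inverseImage.Faithful
  isLeftAdjoint : f.directImage.IsLeftAdjoint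

/-- A local topos: a Grothendieck topos `E` whose geometric morphism to the topos of sets (the one
whose direct image is the global section functor; it is unique up to isomorphism) is local. -/
def IsLocalTopos (E : Type v) [Category.{w} E] : Prop :=
  IsGrothendieckTopos.{u} E ∧ ∃ f : GeometricMorphism E (Type u), f.IsLocal

end Toposes

section Models

variable (C : Type u) [SmallCategory C]

/-- The category `𝕋[Set]` of set-valued models of the finite limit theory `𝕋` with syntactic
category `C`: finite-limit-preserving functors from `C` to sets, and natural transformations. -/
abbrev Model := C ⥤ₗ Type u

/-- The dual `Cᵒᵖ ⥤ 𝕋[Set]` of the syntactic category: it sends `c` to the corepresentable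
model `C(c, -)`. -/
def corep : Cᵒᵖ ⥤ Model C :=
  ObjectProperty.lift _ coyoneda fun c =>
    (inferInstance : PreservesFiniteLimits (coyoneda.obj c))

variable {C}

/-- A saturated class of maps of finite presentation in `𝕋[Set]`. -/
structure IsSaturatedClass (V : MorphismProperty (Model C)) : Prop where
  /-- every map in the class is a map between finitely presented objects -/
  fp : ∀ ⦃K L : Model C⦄ (f : K ⟶ L), V f →
    IsFinitelyPresentable.{u} K ∧ IsFinitelyPresentable.{u} L
  /-- closure under composition -/
  comp : ∀ ⦃K L M : Model C⦄ (f : K ⟶ L) (g : L ⟶ M), V f → V g → V (f ≫ g)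
  /-- all isomorphisms (between finitely presented objects) are in the class -/
  iso : ∀ ⦃K L : Model C⦄ (f : K ⟶ L), IsIso f →
    IsFinitelyPresentable.{u} K → IsFinitelyPresentable.{u} L → V f
  /-- right cancellation -/
  cancel : ∀ ⦃K L M : Model C⦄ (f : K ⟶ L) (g : L ⟶ M), V f → V (f ≫ g) → V g
  /-- closure under pushouts along maps between finitely presented objects -/
  pushout : ∀ ⦃K L K' L' : Model C⦄ (f : K ⟶ L) (a : K ⟶ K') (f' : K' ⟶ L') (b : L ⟶ L'),
    V f → IsFinitelyPresentable.{u} K' → IsPushout a f f' b → V f'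
  /-- closure under finite colimits in the category of arrows of `𝕋[Set]` -/
  colimit : ∀ (I : Type) [SmallCategory I] [FinCategory I] (D : I ⥤ Arrow (Model C))
    (c : Cocone D), IsColimit c → (∀ i, V (D.obj i).hom) → V c.pt.hom

end Models

/-- A geometry `(𝕋, 𝒱, J)` on the finite limit theory `𝕋` with syntactic category `C`: a saturated
class `𝒱` in `𝕋[Set]`, and a Grothendieck topology `J` on `C` generated by families of arrows
whose duals in `𝕋[Set]` belong to `𝒱`. -/
structure Geometry (C : Type u) [SmallCategory C] where
  /-- the saturated class `𝒱` -/
  V : MorphismProperty (Model C)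
  saturated : IsSaturatedClass V
  /-- the Grothendieck topology `J` -/
  J : GrothendieckTopology C
  generated : ∃ P : Precoverage C,
    (∀ (c : C), ∀ R ∈ P c, ∀ (d : C) (f : d ⟶ c), R f → V ((corep C).map f.op)) ∧
      P.toGrothendieck = J

namespace Geometry

variable {C : Type u} [SmallCategory C] (G : Geometry C)

/-- `J`-local objects of `𝕋[Set]` (equivalently, models of the geometric extension `𝕋_J`): for the
dual `(K ⟶ K i)` of any `J`-covering family, every map `K ⟶ A` factors through some `K ⟶ K i`. -/
def IsLocalObject (A : Model C) : Prop :=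
  ∀ (c : C) (I : Type u) (d : I → C) (l : ∀ i, d i ⟶ c), Sieve.ofArrows d l ∈ G.J c →
    ∀ f : (corep C).obj (op c) ⟶ A,
      ∃ (i : I) (g : (corep C).obj (op (d i)) ⟶ A), (corep C).map (l i).op ≫ g = f

/-- The etale generator `𝒱_B`: the full subcategory of the category of objects under `B` on the
maps `n : B ⟶ D` that are pushouts, along some `K ⟶ B`, of some `K ⟶ K'` in `𝒱`. -/
abbrev EtaleGenerator (B : Model C) :=
  ObjectProperty.FullSubcategory fun n : Under B => G.V.pushouts n.hom

/-- The families that generate the spectral topology on `𝒱_Bᵒᵖ`: the duals of the families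
`(m i : n ⟶ n' i)` of maps of `𝒱_B` that, as maps `D ⟶ D' i` between the codomains,
are the pushouts along one map `b : K ⟶ D` of the dual `(K ⟶ K i)` of a `J`-covering family. -/
def spectralPrecoverage (B : Model C) : Precoverage (G.EtaleGenerator B)ᵒᵖ where
  coverings n := {R | ∃ (c : C) (I : Type u) (d : I → C) (l : ∀ i, d i ⟶ c)
    (_ : Sieve.ofArrows d l ∈ G.J c)
    (b : (corep C).obj (op c) ⟶ n.unop.obj.right)
    (n' : I → G.EtaleGenerator B) (m : ∀ i, n.unop ⟶ n' i)
    (k : ∀ i, (corep C).obj (op (d i)) ⟶ (n' i).obj.right),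
    (∀ i, IsPushout b ((corep C).map (l i).op) (m i).hom.right (k i)) ∧
      R = Presieve.ofArrows (fun i => op (n' i)) (fun i => (m i).op)}

/-- The spectral topology `J_B` on `𝒱_Bᵒᵖ`. -/
def spectralTopology (B : Model C) : GrothendieckTopology (G.EtaleGenerator B)ᵒᵖ :=
  (G.spectralPrecoverage B).toGrothendieck

/-- The spectrum `Spec B = Sh(𝒱_Bᵒᵖ, J_B)`. -/
abbrev Spec (B : Model C) := Sheaf (G.spectralTopology B) (Type u)

end Geometry

end SpectralGeometry

namespace SpectralGeometry

section Models

variable {C : Type u} [SmallCategory C]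

/-! In `𝒱_Aᵒᵖ` the identity of `A` is terminal, and an arrow from it to `n : A ⟶ D` is a retraction
`r : D ⟶ A` of `n`. If `D ⟶ D i` are the pushouts of a dual `J`-cover `K ⟶ K i` along `b : K ⟶ D`,
locality of `A` factors `b ≫ r` through some `K i`, so `r` extends to `D i`. Hence covering sieves
contain every arrow from the terminal object, and only the maximal sieve covers that object
(`spectralTopology_le_ofPoint`). Sheaves on such a local site form a local topos. Smallness of the
site holds because finitely presented models are retracts of corepresentables. -/

/-- The Yoneda lemma for corepresentable models. -/
noncomputable def corepEquiv (c : C) (M : Model C) :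
    ((corep C).obj (op c) ⟶ M) ≃ M.obj.obj c :=
  (ObjectProperty.fullyFaithfulι _).homEquiv.trans coyonedaEquiv

lemma corepEquiv_comp {c : C} {M N : Model C} (f : (corep C).obj (op c) ⟶ M) (g : M ⟶ N) :
    corepEquiv c N (f ≫ g) = g.hom.app c (corepEquiv c M f) :=
  rfl

lemma corepEquiv_map_comp {c d : C} {M : Model C} (l : c ⟶ d) (f : (corep C).obj (op c) ⟶ M) :
    corepEquiv d M ((corep C).map l.op ≫ f) = M.obj.map l (corepEquiv c M f) := by
  exact (coyonedaEquiv_naturality f.hom l).symm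

/-- The canonical diagram of corepresentable models over a model. -/
noncomputable def elementsDiagram (M : Model C) : M.obj.Elementsᵒᵖ ⥤ Model C :=
  (CategoryOfElements.π M.obj).op ⋙ corep C

/-- A model is the vertex of a cocone under its canonical diagram. -/
noncomputable def elementsCocone (M : Model C) : Cocone (elementsDiagram M) where
  pt := M
  ι :=
    { app x := (corepEquiv x.unop.1 M).symm x.unop.2
      naturality x y f := by
        apply (corepEquiv x.unop.1 M).injective
        refine (corepEquiv_map_comp f.unop.val _).trans ?_
        have h := (corepEquiv x.unop.1 M).apply_symm_apply x.unop.2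
        rw [Equiv.apply_symm_apply]
        exact (CategoryOfElements.map_snd f.unop).trans h.symm }

/-- A model is the colimit of its canonical diagram. -/
noncomputable def isColimitElementsCocone (M : Model C) : IsColimit (elementsCocone M) where
  desc s := ObjectProperty.homMk
    { app c := TypeCat.ofHom fun x : M.obj.obj c => corepEquiv c s.pt (s.ι.app (op ⟨c, x⟩))
      naturality c d f := by
        ext (x : M.obj.obj c)
        let X : M.obj.Elements := ⟨c, x⟩
        let Y : M.obj.Elements := ⟨d, M.obj.map f x⟩
        let g : X ⟶ Y := CategoryOfElements.homMk X Y f rfl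
        have h := congrArg (corepEquiv d s.pt) (s.w g.op)
        exact h.symm.trans (corepEquiv_map_comp f _) }
  fac s x := by
    apply (corepEquiv x.unop.1 s.pt).injective
    refine (corepEquiv_comp (M := M) _ _).trans ?_
    exact congrArg (fun y => corepEquiv x.unop.1 s.pt (s.ι.app (op ⟨x.unop.1, y⟩)))
      ((corepEquiv x.unop.1 M).apply_symm_apply x.unop.2)
  uniq s m h := by
    apply ObjectProperty.hom_ext
    ext c (x : M.obj.obj c)
    have hx := congrArg (corepEquiv c s.pt) (h (op ⟨c, x⟩))
    refine Eq.trans ?_ hx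
    exact congrArg (fun y => m.hom.app c y) ((corepEquiv c M).apply_symm_apply x).symm


lemma isFiltered_elements_op [HasFiniteLimits C] (M : Model C) : IsFiltered M.obj.Elementsᵒᵖ := by
  have := flat_of_preservesFiniteLimits M.obj
  have : IsCofiltered M.obj.Elements :=
    .of_equivalence (CategoryOfElements.structuredArrowEquivalence _).symm
  infer_instance

lemma isFinitelyPresentable_le_retractClosure [HasFiniteLimits C] :
    ObjectProperty.isFinitelyPresentable.{u} (Model C) ≤
      (ObjectProperty.ofObj (corep C).obj).retractClosure := by
  intro K hK
  have : IsFinitelyPresentable.{u} K := hK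
  have := isFiltered_elements_op K
  -- As `K` is a filtered colimit of corepresentables, its identity factors through one of them.
  obtain ⟨j, p, hp⟩ := IsFinitelyPresentable.exists_hom_of_isColimit
    (isColimitElementsCocone K) (𝟙 K)
  exact ⟨_, ⟨_⟩, ⟨{ i := p, r := (elementsCocone K).ι.app j, retract := hp }⟩⟩

instance essentiallySmall_isFinitelyPresentable [HasFiniteLimits C] :
    ObjectProperty.EssentiallySmall.{u} (ObjectProperty.isFinitelyPresentable.{u} (Model C)) :=
  .of_le isFinitelyPresentable_le_retractClosure

/-- The model corepresented by a terminal object is initial. -/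
noncomputable def isInitialCorepTerminal [HasFiniteLimits C] : IsInitial ((corep C).obj (op (⊤_ C))) := by
  have (M : Model C) : Unique (M.obj.obj (⊤_ C)) :=
    (Types.isTerminalEquivUnique _) (IsTerminal.isTerminalObj M.obj _ terminalIsTerminal)
  have (M : Model C) : Unique ((corep C).obj (op (⊤_ C)) ⟶ M) := (corepEquiv _ M).unique
  exact IsInitial.ofUnique _

lemma isFinitelyPresentable_of_isInitial {K : Model C} (hK : IsInitial K) :
    IsFinitelyPresentable.{u} K :=
  have := Cardinal.fact_isRegular_aleph0
  have (k : Discrete PEmpty.{1}) :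
      IsCardinalPresentable ((Functor.empty (Model C)).obj k) Cardinal.aleph0.{u} :=
    k.as.elim
  isCardinalPresentable_of_isColimit _ hK _
    (hasCardinalLT_of_finite _ _ le_rfl)

end Models

namespace Geometry

variable {C : Type u} [SmallCategory C] [HasFiniteLimits C] (G : Geometry C)

section EtaleGenerator

variable (A : Model C)

/-- Up to isomorphism, a pushout is determined by its span, whose finitely presented vertices range
over a small set. -/
instance essentiallySmall_pushouts :
    ObjectProperty.EssentiallySmall.{u} fun n : Under A => G.V.pushouts n.hom where
  exists_small_le' := by
    obtain ⟨Q, _, -, hQ⟩ := ObjectProperty.EssentiallySmall.exists_small_le.{u}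
      (ObjectProperty.isFinitelyPresentable.{u} (Model C))
    let ι := {i : Σ (K L : Subtype Q), (K.1 ⟶ L.1) × (K.1 ⟶ A) // HasPushout i.2.2.1 i.2.2.2}
    refine ⟨ObjectProperty.ofObj fun i : ι =>
      have := i.2
      Under.mk (pushout.inr i.1.2.2.1 i.1.2.2.2), inferInstance, ?_⟩
    rintro n ⟨K, L, f, a, b, hf, h⟩
    obtain ⟨hK, hL⟩ := G.saturated.fp f hf
    obtain ⟨K', hK', ⟨e⟩⟩ := hQ K hK
    obtain ⟨L', hL', ⟨e'⟩⟩ := hQ L hL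
    have h' : IsPushout (e.inv ≫ f ≫ e'.hom) (e.inv ≫ a) (e'.inv ≫ b) n.hom :=
      h.flip.of_iso e e' (Iso.refl _) (Iso.refl _) (by simp) (by simp) (by simp) (by simp)
    have := h'.hasPushout
    refine ⟨_, ⟨(⟨⟨⟨K', hK'⟩, ⟨L', hL'⟩, e.inv ≫ f ≫ e'.hom, e.inv ≫ a⟩, this⟩ : ι)⟩,
      ⟨Under.isoMk h'.isoPushout ?_⟩⟩
    exact h'.inr_isoPushout_hom

/-- The square pushes out the identity of the initial model, which is finitely presented. -/
lemma pushouts_id : G.V.pushouts (𝟙 A) :=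
  have hK := isFinitelyPresentable_of_isInitial (isInitialCorepTerminal (C := C))
  ⟨_, _, 𝟙 _, isInitialCorepTerminal.to A, isInitialCorepTerminal.to A,
    G.saturated.iso _ inferInstance hK hK, IsPushout.of_vert_isIso ⟨by simp⟩⟩

/-- The identity of `A`, as an object of the etale generator `𝒱_A`. -/
def etaleId : G.EtaleGenerator A := ⟨Under.mk (𝟙 A), G.pushouts_id A⟩

/-- The identity of `A` is a terminal object of the site of the spectrum. -/
def isTerminalEtaleId : IsTerminal (op (G.etaleId A)) :=
  IsTerminal.ofUniqueHom
    (fun n => Quiver.Hom.op (ObjectProperty.homMk (Under.homMk n.unop.obj.hom (by simp [etaleId]))))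
    (fun n m => by
      have hm : 𝟙 A ≫ m.unop.hom.right = n.unop.obj.hom := Under.w m.unop.hom
      refine Quiver.Hom.unop_inj (ObjectProperty.hom_ext _ (Under.UnderMorphism.ext ?_))
      exact (Category.id_comp _).symm.trans hm)

end EtaleGenerator

/-- The Grothendieck topology of the sieves that contain all the arrows from a fixed object. -/
def grothendieckTopologyOfPoint {D : Type*} [Category* D] (T : D) :
    GrothendieckTopology D where
  sieves X := {S | ∀ f : T ⟶ X, S f}
  top_mem' _ _ := trivial
  pullback_stable' _ _ _ g hS f := hS (f ≫ g)
  transitive' X S hS R hR f := by simpa using hR (hS f) (𝟙 T)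

variable {G} {A : Model C}

/-- `J_A` is the least topology containing the generating families, so only these need checking. -/
lemma spectralTopology_le_ofPoint (hA : G.IsLocalObject A) :
    G.spectralTopology A ≤ grothendieckTopologyOfPoint (op (G.etaleId A)) := by
  unfold spectralTopology
  rw [Precoverage.toGrothendieck_eq_sInf]
  refine sInf_le ?_
  rintro n _ ⟨c, I, d, l, hl, b, n', m, k, h, rfl⟩ r
  let r' : n.unop.obj.right ⟶ A := r.unop.hom.right
  obtain ⟨i, g, hg⟩ := hA c I d l hl (b ≫ r')
  have hr : n.unop.obj.hom ≫ r' = 𝟙 A := Under.w r.unop.hom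
  -- The pushout property glues `r'` and `g` into a retraction of `n' i`.
  let s : n' i ⟶ G.etaleId A := ObjectProperty.homMk (Under.homMk ((h i).desc r' g hg.symm) (by
    rw [← Under.w (m i).hom, Category.assoc]
    exact (congrArg _ ((h i).inl_desc _ _ _)).trans hr))
  refine ⟨op (n' i), s.op, (m i).op, ⟨i⟩, ?_⟩
  exact Quiver.Hom.unop_inj (ObjectProperty.hom_ext _
    (Under.UnderMorphism.ext ((h i).inl_desc _ _ _)))

lemma isLocalSite_spectralTopology (hA : G.IsLocalObject A) :
    (G.spectralTopology A).IsLocalSite :=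
  have := (G.isTerminalEtaleId A).hasTerminal
  let e := terminalIsTerminal.uniqueUpToIso (G.isTerminalEtaleId A)
  { eq_top_of_mem := fun S hS => by
      -- The sieve contains `e.inv`, an isomorphism from `etaleId`, hence the identity.
      rw [← Sieve.id_mem_iff_eq_top, ← e.hom_inv_id]
      exact S.downward_closed (spectralTopology_le_ofPoint hA _ hS e.inv) e.hom }

end Geometry

lemma isGrothendieckTopos_sheaf {D : Type w} [Category.{v} D] [EssentiallySmall.{u} D]
    (J : GrothendieckTopology D) : IsGrothendieckTopos.{u} (Sheaf J (Type u)) :=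
  ⟨_, _, _, ⟨(equivSmallModel.{u} D).sheafCongr J
    ((equivSmallModel.{u} D).inverse.inducedTopology J) (Type u)⟩⟩

open GrothendieckTopology in
lemma isLocalTopos_sheaf {D : Type w} [Category.{v} D] [EssentiallySmall.{u} D]
    (J : GrothendieckTopology D) [J.IsLocalSite] : IsLocalTopos.{u} (Sheaf J (Type u)) := by
  have := hasSheafifyEssentiallySmallSite J (Type u)
  have := locallySmall_of_essentiallySmall.{u} D
  refine ⟨isGrothendieckTopos_sheaf J, ⟨constantSheaf J (Type u), Sheaf.Γ J (Type u),
    constantSheafΓAdj J (Type u), ?_⟩, ?_, ?_, ?_⟩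
  · exact comp_preservesFiniteLimits _ _
  · exact IsLocalSite.full_constantSheaf.{u} J (Type u)
  · exact IsLocalSite.faithful_constantSheaf.{u} J (Type u)
  · exact IsLocalSite.Γ_isLeftAdjoint.{u} J (Type u)

end SpectralGeometry

theorem mainTheorem10 (C : Type u) [SmallCategory C] [HasFiniteLimits C]
    (G : SpectralGeometry.Geometry C) (A : SpectralGeometry.Model C) (hA : G.IsLocalObject A) :
    SpectralGeometry.IsLocalTopos.{u} (G.Spec A) := by
  have := SpectralGeometry.Geometry.isLocalSite_spectralTopology hA
  exact SpectralGeometry.isLocalTopos_sheaf _
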